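/- Let $m, N \geq 1$ be integers and let $\xi_1, \ldots, \xi_m$ be complex numbers such that $1, \xi_1, \ldots, \xi_m$ are linearly independent over $\overline{\mathbb Q}$, the field of algebraic numbers in $\mathbb C$. For $\kappa = (\kappa_1,\ldots,\kappa_m) \in \mathbb N^m$ (where $0 \in \mathbb N$) write $|\kappa| = \kappa_1 + \cdots + \kappa_m$, and put $$\Omega = \{\kappa \in \mathbb N^m : N-1 \leq |\kappa| \leq N\}, \qquad \Theta = \{\kappa \in \mathbb N^m : |\kappa| = N\}.$$ Let $(E_\kappa)_{\kappa\in\Omega}$ be the canonical basis of $\mathbb C^\Omega$ and $(e_j)_{1 \leq j \leq m}$ that of $\mathbb Z^m$. For $\kappa \in \Theta$ let $$Z_\kappa = E_\kappa + \sum_{j=1}^m \xi_j E_{\kappa - e_j},$$ with the convention $E_{\kappa - e_j} = 0$ if $\kappa_j = 0$, and let $F = \mathrm{Span}_{\mathbb C}\{Z_\kappa : \kappa \in \Theta\} \subset \mathbb C^\Omega$. Let $R$ be a vector subspace of $\mathbb C^\Omega$ defined over $\overline{\mathbb Q}$, that is, having a $\mathbb C$-basis consisting of vectors in $\overline{\mathbb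 Q}^\Omega$. Then $$\dim R \geq \Big(2 - \frac{m-1}{N+m-1}\Big) \dim (F \cap R),$$ and equality holds if and only if $R = \{0\}$ or $R = \mathbb C^\Omega$. -/

import Mathlib

namespace IrratSubspace

/-- The field of algebraic numbers, i.e. the algebraic closure of `ℚ` inside `ℂ`. -/
noncomputable abbrev Qbar : IntermediateField ℚ ℂ := algebraicClosure ℚ ℂ

/-- The length `|κ| = κ_1 + ... + κ_m` of a multi-index. -/
def len {m : ℕ} (κ : Fin m → ℕ) : ℕ := ∑ i, κ i

/-- The multi-indices `κ ∈ ℕ^m` with `N - 1 ≤ |κ| ≤ N` (used for `N ≥ 1`). -/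
def Omega (m N : ℕ) : Set (Fin m → ℕ) := {κ | N - 1 ≤ len κ ∧ len κ ≤ N}

/-- The multi-indices `κ ∈ ℕ^m` with `|κ| = N`. -/
def Theta (m N : ℕ) : Set (Fin m → ℕ) := {κ | len κ = N}

instance finiteOmega (m N : ℕ) : Finite (Omega m N) := by
  refine Set.Finite.subset (Set.finite_Iic (fun _ : Fin m => N)) ?_
  intro κ hκ i
  exact (Finset.single_le_sum (f := κ) (fun _ _ => Nat.zero_le _) (Finset.mem_univ i)).trans hκ.2

/-- A multi-index seen in `ℤ^m`. -/
def toInt {m : ℕ} (κ : Fin m → ℕ) : Fin m → ℤ := fun i => (κ i : ℤ)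

/-- For `κ ∈ Ω`, the canonical basis vector `E_κ` of `ℂ^Ω`. It is defined for all `κ ∈ ℤ^m`, and
is `0` for `κ ∉ Ω`, in particular when `κ` has a negative component. -/
def E (m N : ℕ) (κ : Fin m → ℤ) : Omega m N → ℂ :=
  fun κ' => if κ = toInt κ'.1 then 1 else 0

/-- `Z_κ = E_κ + ∑_j ξ_j E_{κ - e_j}`. -/
noncomputable def Z {m : ℕ} (N : ℕ) (ξ : Fin m → ℂ) (κ : Fin m → ℕ) : Omega m N → ℂ :=
  E m N (toInt κ) + ∑ j, ξ j • E m N (toInt κ - Pi.single j 1)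

/-- The span of the vectors `Z_κ`, for `|κ| = N`. -/
noncomputable def F {m : ℕ} (N : ℕ) (ξ : Fin m → ℂ) : Submodule ℂ (Omega m N → ℂ) :=
  Submodule.span ℂ (Z N ξ '' Theta m N)

/-- A subspace of `ℂ^ι` is defined over the algebraic numbers if it has a `ℂ`-basis consisting of
vectors with algebraic coordinates. -/
def DefinedOverQbar {ι : Type*} (R : Submodule ℂ (ι → ℂ)) : Prop :=
  ∃ S : Set (ι → ℂ), (∀ v ∈ S, ∀ i, v i ∈ Qbar) ∧
    LinearIndependent ℂ (fun v : S => (v : ι → ℂ)) ∧ Submodule.span ℂ S = R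

end IrratSubspace

/-!
A vector of `ℂ^Ω` is a pair `(P, Q)` of forms of degrees `N` and `N - 1` in `m` variables. When `P`
and `Q` are written in divided powers, `F` is the graph `Q = D_ξ P` of the derivative in the
direction `ξ` (`F_eq_ker_defect`). Hence, if `φ = dim (F ∩ R)` and `r` is the dimension of the space
of all `Q - D_ξ P` with `(P, Q) ∈ R`, then `dim R = φ + r`, and the inequality to prove is
`N φ ≤ (N + m - 1) r`.

Write `K` for the field of algebraic numbers. As `K` is algebraically closed, the algebra `K[ξ]` has
a `K`-point, so that `ξ` specialises to some `s ∈ K^m`. Ranks of matrices can only drop under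
specialisation (`finrank_map_le_of_specialization`), so the space `W` of the forms `P` with
`(P, D_s P) ∈ R` has dimension at least `φ`, and it is rational over `K`. For such a `P` one has
`D_s P - D_ξ P = - D_{ξ - s} P`, hence `r` is at least the dimension of `D_{ξ - s} W`. The
coordinates of `ξ - s` are linearly independent over `K`, and the inequality reduces to the one of
`mul_finrank_le_mul_finrank_polar`:

  `d dim G ≤ (d + m - 1) dim D_η G`

for a rational space `G` of forms of degree `d` and a direction `η` with coordinates linearly
independent over `K`, with equality only if `G` is zero or consists of all forms.

This is proved by induction on `m` and `d`. Let `u ≠ 0` be a rational specialisation of the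
projective point `η`, so that `y = dim D_u G` is at most `δ = dim D_η G`. The induction hypothesis
in degree `d - 1` applies to `D_u G`. The forms of `G` killed by `D_u` are forms on the quotient by
`u`, to which the induction hypothesis in `m - 1` variables applies. As `D_η` and `D_u` commute,
`D_η G` is mapped by `D_u` onto the span of `D_η D_u G`, with a kernel containing the polars of the
forms killed by `D_u` (`finrank_polar_add_finrank_polar_le`). Adding up,
`(d + m - 2) δ ≥ (d - 1) y + d (dim G - y) ≥ d dim G - δ`.
-/

open Module

namespace IrratSubspace

/-! ### Specialisation of algebraic points -/

section Specialization

variable {K L A I J : Type*} [Field K] [Field L] [CommRing A]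

/-- Linear independence can only be lost under specialisation: a nonzero minor of the specialised
family lifts to a nonzero minor of the original one. -/
theorem linearIndependent_of_specialization [Finite J] (π : A →+* K) (ι : A →+* L)
    (hι : Function.Injective ι) (v : J → I → A)
    (h : LinearIndependent K fun j i => π (v j i)) :
    LinearIndependent L fun j i => ι (v j i) := by
  classical
  cases nonempty_fintype J
  let col : I → J → K := fun i j => π (v j i)
  -- the columns of a matrix with independent rows span the whole space
  have hspan : Submodule.span K (Set.range col) = ⊤ := by
    by_contra hne
    obtain ⟨f, hf, hle⟩ := Submodule.exists_le_ker_of_lt_top _ (lt_top_iff_ne_top.2 hne)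
    apply hf
    have hf0 : ∀ j, f (Pi.single j 1) = 0 := by
      refine Fintype.linearIndependent_iff.1 h (fun j => f (Pi.single j 1)) ?_
      funext i
      have h1 : f (col i) = 0 := hle (Submodule.subset_span ⟨i, rfl⟩)
      rw [← (Pi.basisFun K J).sum_repr (col i)] at h1
      simpa [col, mul_comm, Finset.sum_apply] using h1
    exact (Pi.basisFun K J).ext fun j => by simpa using hf0 j
  obtain ⟨b, hb, hbs, hbi⟩ := exists_linearIndependent K (Set.range col)
  let B : Basis b K (J → K) := Basis.mk hbi (by rw [Subtype.range_coe, hbs, hspan])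
  let e : J ≃ b := (Pi.basisFun K J).indexEquiv B
  choose c hc using fun j => hb (e j).2
  let M : Matrix J J A := Matrix.of fun j k => v j (c k)
  have hM : LinearIndependent K (π.mapMatrix M).col := by
    have : (π.mapMatrix M).col = Subtype.val ∘ e := by
      funext k j
      exact congrFun (hc k) j
    rw [this]
    exact hbi.comp _ e.injective
  have hdet : M.det ≠ 0 := by
    intro h0
    have := (Matrix.isUnit_iff_isUnit_det _).1 (Matrix.linearIndependent_cols_iff_isUnit.1 hM)
    rw [← RingHom.map_det, h0, map_zero] at this
    exact not_isUnit_zero this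
  have hL : LinearIndependent L (ι.mapMatrix M).row := by
    rw [Matrix.linearIndependent_rows_iff_isUnit, Matrix.isUnit_iff_isUnit_det, ← RingHom.map_det]
    exact (map_ne_zero_iff ι hι).2 hdet |>.isUnit
  exact LinearIndependent.of_comp (LinearMap.funLeft L L c) hL

/-- The rank of a family of vectors can only drop under specialisation. -/
theorem finrank_span_specialization_le (π : A →+* K) (ι : A →+* L)
    (hι : Function.Injective ι) (X : Set (I → A))
    [FiniteDimensional K (Submodule.span K ((fun v => π ∘ v) '' X))]
    [FiniteDimensional L (Submodule.span L ((fun v => ι ∘ v) '' X))] :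
    finrank K (Submodule.span K ((fun v => π ∘ v) '' X)) ≤
      finrank L (Submodule.span L ((fun v => ι ∘ v) '' X)) := by
  classical
  obtain ⟨b, hb, hbs, hbi⟩ := exists_linearIndependent K ((fun v => π ∘ v) '' X)
  choose c hcX hc using fun j : b => hb j.2
  have hfin : FiniteDimensional K (Submodule.span K b) := by rw [hbs]; infer_instance
  have : Finite b := by
    have h1 : LinearIndependent K fun j : b =>
        (⟨j, Submodule.subset_span j.2⟩ : Submodule.span K b) :=
      LinearIndependent.of_comp (Submodule.span K b).subtype hbi
    exact h1.finite
  cases nonempty_fintype b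
  have hL : LinearIndependent L fun (j : b) i => ι (c j i) := by
    apply linearIndependent_of_specialization π ι hι c
    have : (fun (j : b) i => π (c j i)) = Subtype.val := by
      funext j; exact hc j
    rw [this]; exact hbi
  have h2 : LinearIndependent L fun j : b =>
      (⟨fun i => ι (c j i), Submodule.subset_span ⟨c j, hcX j, rfl⟩⟩ :
        Submodule.span L ((fun v => ι ∘ v) '' X)) :=
    LinearIndependent.of_comp (Submodule.subtype _) hL
  have h3 := finrank_span_eq_card hbi
  rw [Subtype.range_coe, hbs] at h3
  rw [h3]
  exact h2.fintype_card_le_finrank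

/-- Nullstellensatz: a finitely generated algebra over an algebraically closed field has a
rational point. -/
theorem exists_algHom_of_finiteType [IsAlgClosed K] [Algebra K A] [Nontrivial A]
    [Algebra.FiniteType K A] : Nonempty (A →ₐ[K] K) := by
  obtain ⟨M, hM⟩ := Ideal.exists_maximal A
  let _ : Field (A ⧸ M) := Ideal.Quotient.field M
  have : Algebra.FiniteType K (A ⧸ M) :=
    Algebra.FiniteType.of_surjective (Ideal.Quotient.mkₐ K M) (Ideal.Quotient.mkₐ_surjective K M)
  have : Module.Finite K (A ⧸ M) := finite_of_finite_type_of_isJacobsonRing K (A ⧸ M)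
  let e : K ≃ₐ[K] (A ⧸ M) := AlgEquiv.ofBijective (Algebra.ofId K _)
    (IsAlgClosed.algebraMap_bijective_of_isIntegral (k := K) (K := A ⧸ M))
  exact ⟨e.symm.toAlgHom.comp (Ideal.Quotient.mkₐ K M)⟩

end Specialization

/-! ### Dimensions and extension of scalars -/

theorem finrank_map_add_finrank_inf_ker {K V W : Type*} [Field K] [AddCommGroup V] [Module K V]
    [AddCommGroup W] [Module K W] (p : Submodule K V) [FiniteDimensional K p] (f : V →ₗ[K] W) :
    finrank K (p.map f) + finrank K (p ⊓ LinearMap.ker f : Submodule K V) = finrank K p := by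
  have h := LinearMap.finrank_range_add_finrank_ker (f.domRestrict p)
  rw [LinearMap.range_domRestrict, LinearMap.ker_domRestrict] at h
  rw [← h, ← Submodule.map_comap_subtype, ← Submodule.finrank_map_subtype_eq]

theorem finrank_map_eq_of_disjoint_ker {K V W : Type*} [Field K] [AddCommGroup V] [Module K V]
    [AddCommGroup W] [Module K W] (p : Submodule K V) [FiniteDimensional K p] (f : V →ₗ[K] W)
    (h : ∀ x ∈ p, f x = 0 → x = 0) : finrank K (p.map f) = finrank K p := by
  have h0 : p ⊓ LinearMap.ker f = ⊥ := (Submodule.eq_bot_iff _).2 fun x hx => h x hx.1 hx.2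
  have h1 := finrank_map_add_finrank_inf_ker p f
  rwa [h0, finrank_bot, add_zero] at h1

section Extension

variable (K L : Type*) {I : Type*} [Field K] [Field L] [Algebra K L]

/-- The inclusion `K^I → L^I`. -/
def baseMap (I : Type*) : (I → K) →ₗ[K] (I → L) := (Algebra.linearMap K L).compLeft I

variable {K}

/-- The extension of scalars of a subspace of `K^I`, as the `L`-span of this subspace in `L^I`. -/
def extend (V : Submodule K (I → K)) : Submodule L (I → L) :=
  Submodule.span L (baseMap K L I '' V)

@[simp] theorem baseMap_apply (v : I → K) (i : I) : baseMap K L I v i = algebraMap K L (v i) := rfl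

theorem baseMap_mem_extend {V : Submodule K (I → K)} {v : I → K} (hv : v ∈ V) :
    baseMap K L I v ∈ extend L V := Submodule.subset_span ⟨v, hv, rfl⟩

/-- A family spanning `V` over `K` spans its extension over `L`. -/
theorem extend_span (X : Set (I → K)) :
    extend L (Submodule.span K X) = Submodule.span L (baseMap K L I '' X) := by
  apply le_antisymm
  · refine Submodule.span_le.2 ?_
    rintro _ ⟨v, hv, rfl⟩
    have : Submodule.span K X ≤
        ((Submodule.span L (baseMap K L I '' X)).restrictScalars K).comap (baseMap K L I) :=
      Submodule.span_le.2 fun x hx => Submodule.subset_span ⟨x, hx, rfl⟩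
    exact this hv
  · exact Submodule.span_mono (Set.image_mono Submodule.subset_span)

theorem linearIndependent_baseMap {J : Type*} [Finite J] {v : J → I → K}
    (h : LinearIndependent K v) : LinearIndependent L fun j => baseMap K L I (v j) :=
  linearIndependent_of_specialization (RingHom.id K) (algebraMap K L)
    (algebraMap K L).injective v h

instance extend_finiteDimensional (V : Submodule K (I → K)) [FiniteDimensional K V] :
    FiniteDimensional L (extend L V) := by
  obtain ⟨s, hs⟩ := (Submodule.fg_iff_finiteDimensional V).2 inferInstance
  rw [← hs, extend_span]
  exact FiniteDimensional.span_of_finite L (s.finite_toSet.image _)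

theorem finrank_extend (V : Submodule K (I → K)) [FiniteDimensional K V] :
    finrank L (extend L V) = finrank K V := by
  let b := finBasis K V
  have hb : LinearIndependent K fun j => (b j : I → K) :=
    b.linearIndependent.map' V.subtype V.ker_subtype
  have hs : Submodule.span K (Set.range fun j => (b j : I → K)) = V := by
    have := congrArg (Submodule.map V.subtype) b.span_eq
    rwa [Submodule.map_span, Submodule.map_top, Submodule.range_subtype, ← Set.range_comp] at this
  have hV : extend L V = Submodule.span L (Set.range fun j => baseMap K L I (b j)) := by
    conv_lhs => rw [← hs, extend_span, ← Set.range_comp]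
    rfl
  rw [hV, finrank_span_eq_card (linearIndependent_baseMap L hb), Fintype.card_fin]

/-- If a map `fL` over `L`, applied to vectors over `K`, takes values in a subring `A` of `L`, and
if it specialises to the map `fK` along `π : A → K`, then the rank of `fK` is at most that of
`fL`. -/
theorem finrank_map_le_of_specialization {I' : Type*} {A : Subalgebra K L} (π : A →ₐ[K] K)
    (V : Submodule K (I → K)) [FiniteDimensional K V] (f : (I → K) → I' → A)
    (fK : (I → K) →ₗ[K] I' → K) (fL : (I → L) →ₗ[L] I' → L)
    (hK : ∀ v, ⇑π ∘ f v = fK v) (hL : ∀ v, Subtype.val ∘ f v = fL (baseMap K L I v)) :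
    finrank K (V.map fK) ≤ finrank L ((extend L V).map fL) := by
  have h1 : Submodule.span K ((fun v => ⇑(π : A →+* K) ∘ v) '' (f '' V)) = V.map fK := by
    rw [Set.image_image, ← Submodule.span_eq (V.map fK), Submodule.map_coe]
    exact congrArg _ (Set.image_congr fun v _ => hK v)
  have h2 : Submodule.span L ((fun v => ⇑(algebraMap A L) ∘ v) '' (f '' V)) =
      (extend L V).map fL := by
    rw [extend, Submodule.map_span, Set.image_image, Set.image_image]
    exact congrArg _ (Set.image_congr fun v _ => hL v)
  have hf1 : FiniteDimensional K
      (Submodule.span K ((fun v => ⇑(π : A →+* K) ∘ v) '' (f '' V))) := by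
    rw [h1]; infer_instance
  have hf2 : FiniteDimensional L
      (Submodule.span L ((fun v => ⇑(algebraMap A L) ∘ v) '' (f '' V))) := by
    rw [h2]; infer_instance
  have := finrank_span_specialization_le (π : A →+* K) (algebraMap A L)
    Subtype.val_injective (f '' V)
  rwa [h1, h2] at this

end Extension

/-! ### Forms in divided powers and their polars -/

section Forms

variable {m : ℕ}

@[simp] theorem len_add_single (μ : Fin m → ℕ) (j : Fin m) :
    len (μ + Pi.single j 1) = len μ + 1 := by
  simp [len, Finset.sum_add_distrib]

/-- The contraction `P ↦ ∑_j u_j P(· + e_j)`. When `P` is read as the form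
`∑_κ P(κ) X^κ / κ!`, this is the derivative of `P` in the direction `u`. -/
def polar {A : Type*} [CommRing A] (u : Fin m → A) :
    ((Fin m → ℕ) → A) →ₗ[A] ((Fin m → ℕ) → A) where
  toFun P μ := ∑ j, u j * P (μ + Pi.single j 1)
  map_add' P Q := by funext μ; simp [mul_add, Finset.sum_add_distrib]
  map_smul' c P := by funext μ; simp [Finset.mul_sum, mul_left_comm]

theorem polar_apply {A : Type*} [CommRing A] (u : Fin m → A) (P : (Fin m → ℕ) → A)
    (μ : Fin m → ℕ) : polar u P μ = ∑ j, u j * P (μ + Pi.single j 1) := rfl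

theorem polar_comm {A : Type*} [CommRing A] (u v : Fin m → A) (P : (Fin m → ℕ) → A) :
    polar u (polar v P) = polar v (polar u P) := by
  funext μ
  simp only [polar_apply, Finset.mul_sum]
  rw [Finset.sum_comm]
  refine Finset.sum_congr rfl fun i _ => Finset.sum_congr rfl fun j _ => ?_
  rw [add_right_comm, mul_left_comm]

theorem polar_map {A B : Type*} [CommRing A] [CommRing B] (f : A →+* B) (u : Fin m → A)
    (P : (Fin m → ℕ) → A) : f ∘ polar u P = polar (f ∘ u) (f ∘ P) := by
  funext μ; simp [polar_apply]

/-- The forms of degree `d` in `m` variables: the functions on `ℕ^m` supported on `|κ| = d`. -/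
def forms (A : Type*) [CommRing A] (m d : ℕ) : Submodule A ((Fin m → ℕ) → A) where
  carrier := {P | ∀ μ, len μ ≠ d → P μ = 0}
  add_mem' hP hQ μ hμ := by simp [hP μ hμ, hQ μ hμ]
  zero_mem' _ _ := rfl
  smul_mem' c P hP μ hμ := by simp [hP μ hμ]

theorem polar_mem_forms {A : Type*} [CommRing A] (u : Fin m → A) {d : ℕ} {P : (Fin m → ℕ) → A}
    (hP : P ∈ forms A m (d + 1)) : polar u P ∈ forms A m d := by
  intro μ hμ
  rw [polar_apply]
  refine Finset.sum_eq_zero fun j _ => ?_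
  rw [hP _ (by simpa using hμ), mul_zero]

theorem polar_eq_zero_of_mem_forms_zero {A : Type*} [CommRing A] (u : Fin m → A)
    {P : (Fin m → ℕ) → A} (hP : P ∈ forms A m 0) : polar u P = 0 := by
  funext μ
  rw [polar_apply]
  refine Finset.sum_eq_zero fun j _ => ?_
  rw [hP _ (by simp), mul_zero]

instance finiteTheta (m d : ℕ) : Finite (Theta m d) :=
  Set.Finite.subset (Set.toFinite (Omega m d)) fun κ (hκ : len κ = d) =>
    ⟨by omega, hκ.le⟩

theorem forms_ext {A : Type*} [CommRing A] {d : ℕ} {P Q : (Fin m → ℕ) → A}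
    (hP : P ∈ forms A m d) (hQ : Q ∈ forms A m d) (h : ∀ μ, len μ = d → P μ = Q μ) : P = Q := by
  funext μ
  by_cases hμ : len μ = d
  · exact h μ hμ
  · rw [hP μ hμ, hQ μ hμ]

variable (K : Type*) [Field K]

/-- A form of degree `d` is determined by its coefficients. -/
noncomputable def formsEquiv (m d : ℕ) : forms K m d ≃ₗ[K] (Theta m d → K) := by
  classical
  exact
  { toFun := fun P κ => P.1 κ.1
    map_add' := fun _ _ => rfl
    map_smul' := fun _ _ => rfl
    invFun := fun f => ⟨fun μ => if h : len μ = d then f ⟨μ, h⟩ else 0, fun μ hμ => by simp [hμ]⟩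
    left_inv := fun P => Subtype.ext <| by
      funext μ
      by_cases h : len μ = d
      · simp [h]
      · simp [h, P.2 μ h]
    right_inv := fun f => by
      funext κ
      have : len κ.1 = d := κ.2
      simp [this] }

instance forms_finiteDimensional (m d : ℕ) : FiniteDimensional K (forms K m d) :=
  (formsEquiv K m d).symm.finiteDimensional

theorem finrank_forms (m d : ℕ) : finrank K (forms K m d) = Nat.card (Theta m d) := by
  cases nonempty_fintype (Theta m d)
  rw [(formsEquiv K m d).finrank_eq, finrank_fintype_fun_eq_card, Nat.card_eq_fintype_card]

theorem finiteDimensional_of_le_forms {K : Type*} [Field K] {d : ℕ}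
    {G : Submodule K ((Fin m → ℕ) → K)} (hG : G ≤ forms K m d) : FiniteDimensional K G :=
  Submodule.finiteDimensional_of_le hG

end Forms

/-! ### The dimension of the polar of a space of forms -/

section Polar

variable {K L : Type*} [Field K] [Field L] [Algebra K L] {m : ℕ}

theorem baseMap_polar (u : Fin m → K) (P : (Fin m → ℕ) → K) :
    baseMap K L _ (polar u P) = polar (algebraMap K L ∘ u) (baseMap K L _ P) :=
  polar_map (algebraMap K L) u P

theorem map_polar_extend (η : Fin m → L) (G : Submodule K ((Fin m → ℕ) → K)) :
    (extend L G).map (polar η) = Submodule.span L ((fun P => polar η (baseMap K L _ P)) '' G) := by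
  rw [extend, Submodule.map_span, Set.image_image]

theorem extend_map_polar (u : Fin m → K) (G : Submodule K ((Fin m → ℕ) → K)) :
    extend L (G.map (polar u)) = (extend L G).map (polar (algebraMap K L ∘ u)) := by
  rw [map_polar_extend, extend, Submodule.map_coe, Set.image_image]
  simp only [baseMap_polar]

/-- A point with coordinates in an extension of an algebraically closed field `K` has a `K`-rational
specialisation. -/
theorem exists_specialization [IsAlgClosed K] {n : ℕ} (ζ : Fin n → L) :
    ∃ (A : Subalgebra K L) (_ : A →ₐ[K] K) (z : Fin n → A), ∀ j, (z j : L) = ζ j := by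
  let A := Algebra.adjoin K (Set.range ζ)
  have : Algebra.FiniteType K A :=
    (Subalgebra.fg_iff_finiteType _).1 (Subalgebra.fg_def.2 ⟨_, Set.finite_range ζ, rfl⟩)
  obtain ⟨π⟩ := exists_algHom_of_finiteType (K := K) (A := A)
  exact ⟨A, π, fun j => ⟨ζ j, Algebra.subset_adjoin ⟨j, rfl⟩⟩, fun _ => rfl⟩

/-- Among the directions rational over an algebraically closed field, some `u ≠ 0` has a polar of
rank at most that of the given direction `η`: it is a specialisation of the projective point `η`. -/
theorem exists_rational_direction [IsAlgClosed K] (η : Fin (m + 1) → L) (hη : η 0 ≠ 0)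
    (G : Submodule K ((Fin (m + 1) → ℕ) → K)) [FiniteDimensional K G] :
    ∃ u : Fin (m + 1) → K, u 0 = 1 ∧
      finrank K (G.map (polar u)) ≤ finrank L ((extend L G).map (polar η)) := by
  obtain ⟨A, π, z, hz⟩ := exists_specialization (K := K) fun j => (η 0)⁻¹ * η j
  have hz0 : z 0 = 1 := Subtype.ext (by rw [hz]; simp [hη])
  refine ⟨fun j => π (z j), by simp [hz0], ?_⟩
  have h3 : polar η = η 0 • polar fun j => (η 0)⁻¹ * η j := by
    refine LinearMap.ext fun P => funext fun μ => ?_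
    simp [polar_apply, Finset.mul_sum, ← mul_assoc, mul_inv_cancel₀ hη]
  rw [h3, Submodule.map_smul _ _ _ hη]
  refine finrank_map_le_of_specialization L π G (fun P => polar z (algebraMap K A ∘ P)) _ _
    (fun P => ?_) fun P => ?_
  · funext μ
    simp [polar_apply]
  · funext μ
    simp [polar_apply, hz]

/-- The restriction of a form to the multi-indices with vanishing first component, viewed as a form
in one variable less. -/
def restrict (A : Type*) [CommRing A] (m : ℕ) :
    ((Fin (m + 1) → ℕ) → A) →ₗ[A] ((Fin m → ℕ) → A) :=
  LinearMap.funLeft A A fun μ => Fin.cons 0 μ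

@[simp] theorem restrict_apply {A : Type*} [CommRing A] (P : (Fin (m + 1) → ℕ) → A)
    (μ : Fin m → ℕ) : restrict A m P μ = P (Fin.cons 0 μ) := rfl

theorem restrict_mem_forms {A : Type*} [CommRing A] {d : ℕ} {P : (Fin (m + 1) → ℕ) → A}
    (hP : P ∈ forms A (m + 1) d) : restrict A m P ∈ forms A m d := by
  intro μ hμ
  refine hP _ ?_
  simpa [len, Fin.sum_univ_succ] using hμ

/-- A form annihilated by `polar u`, with `u_0 = 1`, lives on the quotient by `u`: it is determined
by its restriction to the remaining variables. -/
theorem eq_zero_of_restrict_eq_zero {A : Type*} [CommRing A] {u : Fin (m + 1) → A} (hu : u 0 = 1)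
    {P : (Fin (m + 1) → ℕ) → A} (hP : polar u P = 0) (hr : restrict A m P = 0) : P = 0 := by
  have key : ∀ (a : ℕ) (μ : Fin (m + 1) → ℕ), μ 0 = a → P μ = 0 := by
    intro a
    induction a with
    | zero =>
      intro μ hμ
      have := congrFun hr (Fin.tail μ)
      rwa [restrict_apply, ← hμ, Fin.cons_self_tail] at this
    | succ a ih =>
      intro μ hμ
      let ν : Fin (m + 1) → ℕ := Function.update μ 0 a
      have h := congrFun hP ν
      rw [polar_apply, Fin.sum_univ_succ, hu, one_mul, Finset.sum_eq_zero, add_zero] at h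
      · have : ν + Pi.single 0 1 = μ := by
          funext i
          refine Fin.cases ?_ (fun i => ?_) i
          · simp [ν, hμ]
          · simp [ν]
        rw [← this, h, Pi.zero_apply]
      · intro j _
        rw [ih, mul_zero]
        simp [ν]
  exact funext fun μ => key _ μ rfl

/-- On the forms annihilated by `polar u`, with `u_0 = 1`, the polar in a direction `η` becomes,
after restriction, the polar in the direction of `η` modulo `u`. -/
theorem restrict_polar {A : Type*} [CommRing A] {u : Fin (m + 1) → A} (hu : u 0 = 1)
    {P : (Fin (m + 1) → ℕ) → A} (hP : polar u P = 0) (η : Fin (m + 1) → A) :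
    restrict A m (polar η P) = polar (fun j => η j.succ - η 0 * u j.succ) (restrict A m P) := by
  funext μ
  have h := congrFun hP (Fin.cons 0 μ)
  have hs : ∀ j : Fin m, (Fin.cons 0 μ + Pi.single j.succ 1 : Fin (m + 1) → ℕ) =
      Fin.cons 0 (μ + Pi.single j 1) := by
    intro j
    funext i
    refine Fin.cases ?_ (fun i => ?_) i
    · simp
    · simp [Pi.single_apply]
  simp only [restrict_apply, polar_apply, Fin.sum_univ_succ, hu, hs, Pi.zero_apply, sub_mul,
    Finset.sum_sub_distrib, one_mul] at h ⊢
  rw [eq_neg_of_add_eq_zero_left h]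
  simp only [mul_assoc, ← Finset.mul_sum]
  ring

/-- The direction of `η` modulo a rational direction `u` still has independent coordinates. -/
theorem linearIndependent_direction_mod {η : Fin (m + 1) → L} (hη : LinearIndependent K η)
    (u : Fin (m + 1) → K) :
    LinearIndependent K fun j : Fin m => η j.succ - η 0 * algebraMap K L (u j.succ) := by
  rw [Fintype.linearIndependent_iff] at hη ⊢
  intro g hg j
  refine hη (Fin.cons (-∑ j, g j * u j.succ) g) ?_ j.succ
  rw [Fin.sum_univ_succ, ← hg]
  simp only [Fin.cons_zero, Fin.cons_succ, smul_sub, Finset.sum_sub_distrib, neg_smul,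
    Finset.sum_smul]
  rw [neg_add_eq_sub]
  congr 1
  refine Finset.sum_congr rfl fun j _ => ?_
  simp only [Algebra.smul_def, map_mul]
  ring

theorem forms_zero_variables (A : Type*) [CommRing A] (d : ℕ) : forms A 0 (d + 1) = ⊥ := by
  refine (Submodule.eq_bot_iff _).2 fun P hP => funext fun μ => hP μ ?_
  simp [len]

theorem finrank_forms_zero (K : Type*) [Field K] (m : ℕ) : finrank K (forms K m 0) = 1 := by
  rw [finrank_forms, Nat.card_eq_one_iff_unique]
  refine ⟨⟨fun κ κ' => Subtype.ext ?_⟩, ⟨⟨0, by simp [Theta, len]⟩⟩⟩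
  have h : ∀ κ : Theta m 0, κ.1 = 0 := fun κ => funext fun i => by
    have h1 : ∑ i, κ.1 i = 0 := κ.2
    exact Finset.sum_eq_zero_iff.1 h1 i (Finset.mem_univ i)
  rw [h, h]

/-- The polars of the polar in a rational direction `u`, and the polars of the forms
annihilated by `polar u`, contribute independently to the rank. -/
theorem finrank_polar_add_finrank_polar_le (η : Fin (m + 1) → L) {u : Fin (m + 1) → K}
    (hu : u 0 = 1) (G : Submodule K ((Fin (m + 1) → ℕ) → K)) [FiniteDimensional K G] :
    finrank L ((extend L (G.map (polar u))).map (polar η)) +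
      finrank L ((extend L ((G ⊓ LinearMap.ker (polar u)).map (restrict K m))).map
        (polar fun j => η j.succ - η 0 * algebraMap K L (u j.succ))) ≤
      finrank L ((extend L G).map (polar η)) := by
  rw [← finrank_map_add_finrank_inf_ker ((extend L G).map (polar η))
    (polar (algebraMap K L ∘ u))]
  refine Nat.add_le_add (le_of_eq ?_) ?_
  · rw [extend_map_polar, ← Submodule.map_comp, ← Submodule.map_comp]
    have : (polar η).comp (polar (algebraMap K L ∘ u)) =
        (polar (algebraMap K L ∘ u)).comp (polar η) :=
      LinearMap.ext fun P => polar_comm _ _ P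
    rw [this]
  · refine le_trans (Submodule.finrank_mono ?_) (Submodule.finrank_map_le (restrict L m) _)
    rw [map_polar_extend, Submodule.span_le]
    rintro _ ⟨_, ⟨P, ⟨hPG, hPu⟩, rfl⟩, rfl⟩
    have hPL : polar (algebraMap K L ∘ u) (baseMap K L _ P) = 0 := by
      rw [← baseMap_polar, LinearMap.mem_ker.1 hPu, map_zero]
    refine ⟨polar η (baseMap K L _ P), ⟨⟨_, baseMap_mem_extend L hPG, rfl⟩, ?_⟩, ?_⟩
    · rw [SetLike.mem_coe, LinearMap.mem_ker, polar_comm, hPL, map_zero]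
    · exact restrict_polar (u := algebraMap K L ∘ u) (by simp [hu]) hPL η

theorem finrank_map_polar_extend_eq_zero (η : Fin m → L) {G : Submodule K ((Fin m → ℕ) → K)}
    (hG : G ≤ forms K m 0) : finrank L ((extend L G).map (polar η)) = 0 := by
  suffices h : (extend L G).map (polar η) = ⊥ by rw [h, finrank_bot]
  rw [map_polar_extend, Submodule.span_eq_bot]
  rintro _ ⟨P, hP, rfl⟩
  refine polar_eq_zero_of_mem_forms_zero η fun μ hμ => ?_
  rw [baseMap_apply, hG hP μ hμ, map_zero]

theorem eq_bot_or_eq_forms_zero {G : Submodule K ((Fin m → ℕ) → K)}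
    (hG : G ≤ forms K m 0) : G = ⊥ ∨ G = forms K m 0 := by
  have : FiniteDimensional K G := finiteDimensional_of_le_forms hG
  have h := Submodule.finrank_mono hG
  rw [finrank_forms_zero] at h
  rcases Nat.le_one_iff_eq_zero_or_eq_one.1 h with h0 | h1
  · exact Or.inl (Submodule.finrank_eq_zero.1 h0)
  · exact Or.inr (Submodule.eq_of_le_of_finrank_eq hG (by rw [h1, finrank_forms_zero]))

/-- A rational space `G` of forms of degree `d` in `m` variables has, in a direction `η` with
linearly independent coordinates, a space of polars whose dimension `δ` satisfies
`d dim G ≤ (d + m - 1) δ`. Equality holds only if `G` is zero or consists of all forms. -/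
theorem mul_finrank_le_mul_finrank_polar [IsAlgClosed K] (m d : ℕ) (η : Fin m → L)
    (hη : LinearIndependent K η) (G : Submodule K ((Fin m → ℕ) → K)) (hG : G ≤ forms K m d) :
    d * finrank K G + finrank L ((extend L G).map (polar η)) ≤
        (d + m) * finrank L ((extend L G).map (polar η)) ∧
      (d * finrank K G + finrank L ((extend L G).map (polar η)) =
        (d + m) * finrank L ((extend L G).map (polar η)) → G = ⊥ ∨ G = forms K m d) := by
  induction m generalizing d with
  | zero =>
    cases d with
    | zero => simp [finrank_map_polar_extend_eq_zero η hG, eq_bot_or_eq_forms_zero hG]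
    | succ d =>
      have hbot : G = ⊥ := le_bot_iff.1 (hG.trans (forms_zero_variables K d).le)
      subst hbot
      have hδ : finrank L ((extend L (⊥ : Submodule K ((Fin 0 → ℕ) → K))).map (polar η)) = 0 := by
        rw [map_polar_extend]
        simp
      rw [hδ]
      simp
  | succ m ihm =>
    induction d generalizing G with
    | zero => simp [finrank_map_polar_extend_eq_zero η hG, eq_bot_or_eq_forms_zero hG]
    | succ d ihd =>
      have : FiniteDimensional K G := finiteDimensional_of_le_forms hG
      obtain ⟨u, hu, hy⟩ := exists_rational_direction η (hη.ne_zero 0) G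
      have hsum := finrank_polar_add_finrank_polar_le η hu G
      have hg := finrank_map_add_finrank_inf_ker G (polar u)
      have hres := finrank_map_eq_of_disjoint_ker (G ⊓ LinearMap.ker (polar u)) (restrict K m)
        fun P hP hr => eq_zero_of_restrict_eq_zero hu hP.2 hr
      have hGu : G.map (polar u) ≤ forms K (m + 1) d := by
        rintro _ ⟨P, hP, rfl⟩
        exact polar_mem_forms u (hG hP)
      have hGr : (G ⊓ LinearMap.ker (polar u)).map (restrict K m) ≤ forms K m (d + 1) := by
        rintro _ ⟨P, hP, rfl⟩
        exact restrict_mem_forms (hG hP.1)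
      obtain ⟨h1, e1⟩ := ihd (G.map (polar u)) hGu
      obtain ⟨h2, e2⟩ := ihm (d + 1) _ (linearIndependent_direction_mod hη u) _ hGr
      rw [hres] at h2 e2
      have hbot : finrank K G = 0 → G = ⊥ := Submodule.finrank_eq_zero.1
      generalize finrank L ((extend L G).map (polar η)) = δ at *
      generalize finrank L ((extend L (G.map (polar u))).map (polar η)) = x at *
      generalize finrank L ((extend L ((G ⊓ LinearMap.ker (polar u)).map (restrict K m))).map
        (polar fun j => η j.succ - η 0 * algebraMap K L (u j.succ))) = z at *
      have hy0 : finrank K (G.map (polar u)) = 0 ↔ G.map (polar u) = ⊥ :=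
        Submodule.finrank_eq_zero
      generalize finrank K (G ⊓ LinearMap.ker (polar u) : Submodule K _) = k at *
      generalize finrank K (G.map (polar u)) = y at *
      generalize finrank K G = g at *
      -- `(d + m) δ ≥ (d + m) (x + z) ≥ d y + (d + 1) k = (d + 1) g - y ≥ (d + 1) g - δ`
      have hmul : (d + m) * (x + z) ≤ (d + m) * δ := Nat.mul_le_mul_left _ hsum
      refine ⟨by nlinarith, fun he => ?_⟩
      have hyδ : y = δ := by nlinarith
      have hE1 : d * y + x = (d + (m + 1)) * x := by nlinarith
      have hE2 : (d + 1) * k + z = (d + 1 + m) * z := by nlinarith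
      have htop : (G ⊓ LinearMap.ker (polar u)).map (restrict K m) = forms K m (d + 1) →
          G.map (polar u) = forms K (m + 1) d → G = forms K (m + 1) (d + 1) := by
        intro ha hb
        refine le_antisymm hG fun P hP => ?_
        have hP1 : polar u P ∈ G.map (polar u) := hb ▸ polar_mem_forms u hP
        obtain ⟨Q, hQ, hQP⟩ := hP1
        have hP2 : restrict K m (P - Q) ∈ (G ⊓ LinearMap.ker (polar u)).map (restrict K m) :=
          ha ▸ restrict_mem_forms (sub_mem hP (hG hQ))
        obtain ⟨T, ⟨hT, hTu⟩, hTP⟩ := hP2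
        have h0 : P - Q - T = 0 := by
          refine eq_zero_of_restrict_eq_zero hu ?_ ?_
          · rw [map_sub, map_sub, hQP, LinearMap.mem_ker.1 hTu, sub_self, sub_zero]
          · rw [map_sub, hTP, sub_self]
        have : P = Q + T := by rw [← sub_eq_zero, ← h0]; abel
        exact this ▸ add_mem hQ hT
      rcases e1 hE1 with hb | hb
      · left
        have hy' : y = 0 := hy0.2 hb
        have hδ0 : δ = 0 := by omega
        subst hδ0
        refine hbot ?_
        simpa using he
      · rcases e2 hE2 with ha | ha
        · have hk0 : k = 0 := by rw [← hres, ha, finrank_bot]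
          cases m with
          | zero => exact Or.inr (htop (by rw [ha, forms_zero_variables]) hb)
          | succ m =>
            left
            refine hbot ?_
            have : (m + 1) * g = 0 := by nlinarith
            simpa using this
        · exact Or.inr (htop ha hb)

end Polar

/-! ### The subspace `F` as a graph -/

section Defect

variable {m N : ℕ}

/-- The part of degree `N` of a vector of `A^Ω`, extended by zero. -/
def topPart (A : Type*) [CommRing A] (m N : ℕ) :
    (Omega m N → A) →ₗ[A] ((Fin m → ℕ) → A) where
  toFun w μ := if h : len μ = N then w ⟨μ, by omega, h.le⟩ else 0
  map_add' v w := by funext μ; by_cases h : len μ = N <;> simp [h]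
  map_smul' c w := by funext μ; by_cases h : len μ = N <;> simp [h]

/-- The part of degree `N - 1` of a vector of `A^Ω`, extended by zero. -/
def lowPart (A : Type*) [CommRing A] (m N : ℕ) :
    (Omega m N → A) →ₗ[A] ((Fin m → ℕ) → A) where
  toFun w μ := if h : len μ + 1 = N then w ⟨μ, by omega, by omega⟩ else 0
  map_add' v w := by funext μ; by_cases h : len μ + 1 = N <;> simp [h]
  map_smul' c w := by funext μ; by_cases h : len μ + 1 = N <;> simp [h]

theorem topPart_apply {A : Type*} [CommRing A] (w : Omega m N → A) (μ : Fin m → ℕ) :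
    topPart A m N w μ = if h : len μ = N then w ⟨μ, by omega, h.le⟩ else 0 := rfl

theorem lowPart_apply {A : Type*} [CommRing A] (w : Omega m N → A) (μ : Fin m → ℕ) :
    lowPart A m N w μ = if h : len μ + 1 = N then w ⟨μ, by omega, by omega⟩ else 0 := rfl

theorem topPart_mem_forms {A : Type*} [CommRing A] (w : Omega m N → A) :
    topPart A m N w ∈ forms A m N := fun μ hμ => by simp [topPart_apply, hμ]

theorem topPart_map {A B : Type*} [CommRing A] [CommRing B] (f : A →+* B) (w : Omega m N → A) :
    f ∘ topPart A m N w = topPart B m N (f ∘ w) := by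
  funext μ; by_cases h : len μ = N <;> simp [topPart_apply, h]

theorem lowPart_map {A B : Type*} [CommRing A] [CommRing B] (f : A →+* B) (w : Omega m N → A) :
    f ∘ lowPart A m N w = lowPart B m N (f ∘ w) := by
  funext μ; by_cases h : len μ + 1 = N <;> simp [lowPart_apply, h]

theorem eq_zero_of_parts_eq_zero {A : Type*} [CommRing A] {w : Omega m N → A}
    (ht : topPart A m N w = 0) (hl : lowPart A m N w = 0) : w = 0 := by
  funext κ
  obtain ⟨κ, h1, h2⟩ := κ
  by_cases h : len κ = N
  · simpa [topPart_apply, h] using congrFun ht κ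
  · have h' : len κ + 1 = N := by omega
    simpa [lowPart_apply, h'] using congrFun hl κ

/-- The obstruction for a pair `(P, Q)` of forms of degrees `N` and `N - 1` to lie on the graph of
the polar in the direction `s`. -/
def defect {A : Type*} [CommRing A] (N : ℕ) (s : Fin m → A) :
    (Omega m N → A) →ₗ[A] ((Fin m → ℕ) → A) :=
  lowPart A m N - (polar s).comp (topPart A m N)

theorem defect_apply {A : Type*} [CommRing A] (s : Fin m → A) (w : Omega m N → A) :
    defect N s w = lowPart A m N w - polar s (topPart A m N w) := rfl

theorem defect_map {A B : Type*} [CommRing A] [CommRing B] (f : A →+* B) (s : Fin m → A)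
    (w : Omega m N → A) : f ∘ defect N s w = defect N (f ∘ s) (f ∘ w) := by
  rw [defect_apply, defect_apply, ← lowPart_map, ← topPart_map, ← polar_map]
  funext μ
  simp

theorem eq_zero_of_defect_eq_zero {A : Type*} [CommRing A] {s : Fin m → A} {w : Omega m N → A}
    (hd : defect N s w = 0) (ht : topPart A m N w = 0) : w = 0 := by
  refine eq_zero_of_parts_eq_zero ht ?_
  rwa [defect_apply, ht, map_zero, sub_zero] at hd

theorem E_toInt (κ : Fin m → ℕ) (κ' : Omega m N) :
    E m N (toInt κ) κ' = if κ = κ'.1 then 1 else 0 := by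
  have : toInt κ = toInt κ'.1 ↔ κ = κ'.1 := by simp [toInt, funext_iff]
  simp only [E, this]

theorem E_toInt_sub_single (κ : Fin m → ℕ) (j : Fin m) (κ' : Omega m N) :
    E m N (toInt κ - Pi.single j 1) κ' = if κ = κ'.1 + Pi.single j 1 then 1 else 0 := by
  have : toInt κ - Pi.single j 1 = toInt κ'.1 ↔ κ = κ'.1 + Pi.single j 1 := by
    rw [sub_eq_iff_eq_add, funext_iff, funext_iff]
    refine forall_congr' fun i => ?_
    simp only [toInt, Pi.add_apply, Pi.single_apply]
    split_ifs <;> norm_cast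
  simp only [E, this]

theorem Z_apply (ξ : Fin m → ℂ) (κ : Fin m → ℕ) (κ' : Omega m N) :
    Z N ξ κ κ' = (if κ = κ'.1 then 1 else 0) +
      ∑ j, ξ j * (if κ = κ'.1 + Pi.single j 1 then 1 else 0) := by
  simp only [Z, Pi.add_apply, Finset.sum_apply, Pi.smul_apply, E_toInt, E_toInt_sub_single,
    smul_eq_mul]

theorem Z_apply_of_len_eq (ξ : Fin m → ℂ) {κ : Fin m → ℕ} (hκ : len κ = N) {κ' : Omega m N}
    (hκ' : len κ'.1 = N) : Z N ξ κ κ' = if κ = κ'.1 then 1 else 0 := by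
  rw [Z_apply, Finset.sum_eq_zero, add_zero]
  intro j _
  rw [if_neg, mul_zero]
  rintro rfl
  simp at hκ
  omega

theorem defect_Z (ξ : Fin m → ℂ) {κ : Fin m → ℕ} (hκ : len κ = N) :
    defect N ξ (Z N ξ κ) = 0 := by
  funext μ
  rw [defect_apply, Pi.sub_apply, Pi.zero_apply, sub_eq_zero, lowPart_apply, polar_apply]
  by_cases h : len μ + 1 = N
  · rw [dif_pos h, Z_apply, if_neg (by rintro rfl; omega), zero_add]
    refine Finset.sum_congr rfl fun j _ => ?_
    rw [topPart_apply, dif_pos (by simpa using h), Z_apply_of_len_eq ξ hκ (by simpa using h)]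
  · rw [dif_neg h, Finset.sum_eq_zero]
    intro j _
    rw [topPart_apply, dif_neg (by simpa using h), mul_zero]

theorem F_eq_span_range (ξ : Fin m → ℂ) :
    F N ξ = Submodule.span ℂ (Set.range fun κ : Theta m N => Z N ξ κ) := by
  rw [F, Set.image_eq_range]

/-- `F` is the graph of the polar in the direction `ξ`. -/
theorem F_eq_ker_defect (ξ : Fin m → ℂ) : F N ξ = LinearMap.ker (defect N ξ) := by
  classical
  cases nonempty_fintype (Theta m N)
  have hle : F N ξ ≤ LinearMap.ker (defect N ξ) := by
    rw [F, Submodule.span_le]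
    rintro _ ⟨κ, hκ, rfl⟩
    exact defect_Z ξ hκ
  refine le_antisymm hle fun v hv => ?_
  -- an element of the graph is determined by its part of degree `N`
  let w : Omega m N → ℂ := ∑ κ : Theta m N, topPart ℂ m N v κ • Z N ξ κ
  have hw : w ∈ F N ξ := sum_mem fun κ _ =>
    Submodule.smul_mem _ _ (Submodule.subset_span ⟨κ, κ.2, rfl⟩)
  have hvw : v - w = 0 := by
    refine eq_zero_of_defect_eq_zero (s := ξ) (LinearMap.mem_ker.1 (sub_mem hv (hle hw))) ?_
    rw [map_sub, sub_eq_zero]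
    refine forms_ext (topPart_mem_forms _) (topPart_mem_forms _) fun μ hμ => ?_
    rw [topPart_apply w, dif_pos hμ]
    simp only [w]
    rw [Finset.sum_apply,
      Finset.sum_eq_single (⟨μ, hμ⟩ : Theta m N)]
    · rw [Pi.smul_apply, Z_apply_of_len_eq ξ hμ hμ, if_pos rfl, smul_eq_mul, mul_one]
    · intro κ _ hne
      rw [Pi.smul_apply, Z_apply_of_len_eq ξ κ.2 hμ, if_neg fun h => hne (Subtype.ext h),
        smul_zero]
    · simp
  rwa [sub_eq_zero.1 hvw]

theorem finrank_F (ξ : Fin m → ℂ) : finrank ℂ (F N ξ) = Nat.card (Theta m N) := by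
  classical
  cases nonempty_fintype (Theta m N)
  rw [F_eq_span_range, finrank_span_eq_card, Nat.card_eq_fintype_card]
  rw [Fintype.linearIndependent_iff]
  intro g hg κ
  have hκ : len κ.1 = N := κ.2
  have h := congrFun hg ⟨κ.1, by omega, hκ.le⟩
  rw [Finset.sum_apply, Finset.sum_eq_single κ] at h
  · rwa [Pi.smul_apply, Z_apply_of_len_eq ξ hκ hκ, if_pos rfl, smul_eq_mul, mul_one] at h
  · intro κ' _ hne
    rw [Pi.smul_apply, Z_apply_of_len_eq ξ κ'.2 hκ, if_neg fun h => hne (Subtype.ext h), smul_zero]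
  · simp

end Defect

/-! ### Counting multi-indices -/

theorem card_Theta (m d : ℕ) : Nat.card (Theta m d) = (m + d - 1).choose d := by
  have e : Sym (Fin m) d ≃ Theta m d := Sym.equivNatSumOfFintype (Fin m) d
  rw [← Nat.card_congr e, Nat.card_eq_fintype_card, Sym.card_sym_eq_choose, Fintype.card_fin]

theorem card_Theta_succ_mul (k M : ℕ) :
    Nat.card (Theta (k + 1) (M + 1)) * (M + 1) = (M + 1 + k) * Nat.card (Theta (k + 1) M) := by
  rw [card_Theta, card_Theta, show k + 1 + (M + 1) - 1 = k + M + 1 by omega,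
    show k + 1 + M - 1 = k + M by omega, show M + 1 + k = k + M + 1 by omega,
    ← Nat.add_one_mul_choose_eq]

theorem card_Omega (m M : ℕ) :
    Nat.card (Omega m (M + 1)) = Nat.card (Theta m (M + 1)) + Nat.card (Theta m M) := by
  have h : Omega m (M + 1) = Theta m (M + 1) ∪ Theta m M := by
    ext κ
    simp only [Omega, Theta, Set.mem_ofPred_eq, Set.mem_union]
    omega
  have hd : Disjoint (Theta m (M + 1)) (Theta m M) := by
    rw [Set.disjoint_left]
    intro κ (h1 : len κ = _) (h2 : len κ = _)
    omega
  simp only [Nat.card_coe_set_eq]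
  rw [h, Set.ncard_union_eq hd (Set.toFinite (Theta m (M + 1))) (Set.toFinite (Theta m M))]

/-! ### Rational subspaces and the graph -/

/-- For a rational subspace of `L^Ω` meeting the graph of the polar in the direction `ξ` in
dimension `φ`, with image of dimension `r` under the defect, `N φ ≤ (N + m - 1) r`. The direction `ξ`
specialises to a rational direction `s`, on whose graph the subspace cuts out a space of dimension
at least `φ`. The polars in the direction `ξ - s` of the forms in this space are defects. -/
theorem mul_finrank_inf_ker_defect_le {K L : Type*} [Field K] [Field L] [Algebra K L]
    [IsAlgClosed K] {k N : ℕ} (hN : 1 ≤ N) (ξ : Fin (k + 1) → L)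
    (hξ : LinearIndependent K (Fin.cons 1 ξ : Fin (k + 2) → L))
    (V : Submodule K (Omega (k + 1) N → K)) :
    N * finrank L (extend L V ⊓ LinearMap.ker (defect N ξ) : Submodule L _) ≤
        (N + k) * finrank L ((extend L V).map (defect N ξ)) ∧
      (N * finrank L (extend L V ⊓ LinearMap.ker (defect N ξ) : Submodule L _) =
        (N + k) * finrank L ((extend L V).map (defect N ξ)) →
        finrank L (extend L V ⊓ LinearMap.ker (defect N ξ) : Submodule L _) = 0 ∨
        finrank L (extend L V ⊓ LinearMap.ker (defect N ξ) : Submodule L _) =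
          Nat.card (Theta (k + 1) N)) := by
  obtain ⟨A, π, z, hz⟩ := exists_specialization (K := K) ξ
  let s : Fin (k + 1) → K := fun j => π (z j)
  have hr : finrank K (V.map (defect N s)) ≤ finrank L ((extend L V).map (defect N ξ)) := by
    refine finrank_map_le_of_specialization L π V (fun w => defect N z (algebraMap K A ∘ w)) _ _
      (fun w => ?_) fun w => ?_
    · refine (defect_map (π : A →+* K) z _).trans ?_
      congr 1
      funext κ
      simp
    · refine (defect_map (algebraMap A L) z _).trans ?_
      have : ⇑(algebraMap A L) ∘ z = ξ := funext hz
      rw [this]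
      rfl
  let W := (V ⊓ LinearMap.ker (defect N s)).map (topPart K (k + 1) N)
  have hWle : W ≤ forms K (k + 1) N := by
    rintro _ ⟨w, -, rfl⟩
    exact topPart_mem_forms w
  have hW : finrank K W = finrank K (V ⊓ LinearMap.ker (defect N s) : Submodule K _) :=
    finrank_map_eq_of_disjoint_ker _ _ fun w hw ht => eq_zero_of_defect_eq_zero hw.2 ht
  have hV := finrank_map_add_finrank_inf_ker V (defect N s)
  have hVL := finrank_map_add_finrank_inf_ker (extend L V) (defect N ξ)
  rw [finrank_extend] at hVL
  have hη : LinearIndependent K fun j => ξ j - algebraMap K L (s j) := by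
    -- `ξ - s` is the direction of `(1, ξ)` modulo `(1, s)`; the first component of the second vector
    -- plays no role in the lemma
    simpa using linearIndependent_direction_mod hξ (Fin.cons 0 s : Fin (k + 2) → K)
  have hδ : finrank L ((extend L W).map (polar fun j => ξ j - algebraMap K L (s j))) ≤
      finrank L ((extend L V).map (defect N ξ)) := by
    refine Submodule.finrank_mono ?_
    rw [map_polar_extend, Submodule.span_le]
    rintro _ ⟨_, ⟨w, ⟨hwV, hws⟩, rfl⟩, rfl⟩
    refine ⟨-baseMap K L _ w, neg_mem (baseMap_mem_extend L hwV), ?_⟩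
    have h1 : lowPart L (k + 1) N (baseMap K L _ w) =
        polar (algebraMap K L ∘ s) (topPart L (k + 1) N (baseMap K L _ w)) := by
      rw [← sub_eq_zero, ← defect_apply]
      refine (defect_map (algebraMap K L) s w).symm.trans ?_
      rw [LinearMap.mem_ker.1 hws]
      funext μ
      simp
    have h2 : baseMap K L _ (topPart K (k + 1) N w) =
        topPart L (k + 1) N (baseMap K L _ w) := topPart_map (algebraMap K L) w
    beta_reduce
    rw [map_neg, defect_apply, h1, h2]
    funext μ
    simp [polar_apply, sub_mul, Finset.sum_sub_distrib]
  obtain ⟨h, he⟩ := mul_finrank_le_mul_finrank_polar (k + 1) N _ hη W hWle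
  have hbot : W = ⊥ → finrank K W = 0 := fun h => by rw [h, finrank_bot]
  have htop : W = forms K (k + 1) N → finrank K W = Nat.card (Theta (k + 1) N) := fun h => by
    rw [h, finrank_forms]
  generalize finrank L ((extend L W).map (polar fun j => ξ j - algebraMap K L (s j))) = δ at *
  generalize finrank L (extend L V ⊓ LinearMap.ker (defect N ξ) : Submodule L _) = φ at *
  generalize finrank L ((extend L V).map (defect N ξ)) = r at *
  rw [← hW] at hV
  generalize finrank K W = w at *
  have hφw : φ ≤ w := by omega
  have h1 : N * φ ≤ N * w := Nat.mul_le_mul_left _ hφw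
  have h2 : (N + k) * δ ≤ (N + k) * r := Nat.mul_le_mul_left _ hδ
  refine ⟨by nlinarith, fun heq => ?_⟩
  have h3 : N * φ = N * w := by nlinarith
  have hφ : φ = w := Nat.eq_of_mul_eq_mul_left hN h3
  rw [hφ]
  exact (he (by nlinarith)).imp hbot htop

instance isAlgClosed_Qbar : IsAlgClosed Qbar := (algebraicClosure.isAlgClosure ℚ ℂ).isAlgClosed

theorem DefinedOverQbar.exists_extend {ι : Type*} {R : Submodule ℂ (ι → ℂ)}
    (hR : DefinedOverQbar R) : ∃ V : Submodule Qbar (ι → Qbar), extend ℂ V = R := by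
  obtain ⟨S, hS, -, hspan⟩ := hR
  refine ⟨Submodule.span Qbar {w | baseMap Qbar ℂ ι w ∈ S}, ?_⟩
  rw [extend_span, ← hspan]
  congr 1
  refine Set.Subset.antisymm (Set.image_subset_iff.2 fun _ h => h) fun v hv => ?_
  exact ⟨fun i => ⟨v i, hS v hv i⟩, hv, rfl⟩

end IrratSubspace

open IrratSubspace in
theorem mainTheorem2 (m N : ℕ) (hm : 1 ≤ m) (hN : 1 ≤ N) (ξ : Fin m → ℂ)
    (hξ : LinearIndependent IrratSubspace.Qbar (Fin.cons 1 ξ : Fin (m + 1) → ℂ))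
    (R : Submodule ℂ (IrratSubspace.Omega m N → ℂ)) (hR : IrratSubspace.DefinedOverQbar R) :
    (Module.finrank ℂ R : ℝ) ≥
        (2 - ((m : ℝ) - 1) / ((N : ℝ) + m - 1)) *
          (Module.finrank ℂ (IrratSubspace.F N ξ ⊓ R : Submodule ℂ _) : ℝ) ∧
    ((Module.finrank ℂ R : ℝ) =
        (2 - ((m : ℝ) - 1) / ((N : ℝ) + m - 1)) *
          (Module.finrank ℂ (IrratSubspace.F N ξ ⊓ R : Submodule ℂ _) : ℝ) ↔
      R = ⊥ ∨ R = ⊤) := by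
  obtain ⟨k, rfl⟩ : ∃ k, m = k + 1 := ⟨m - 1, by omega⟩
  obtain ⟨M, rfl⟩ : ∃ M, N = M + 1 := ⟨N - 1, by omega⟩
  obtain ⟨V, rfl⟩ := hR.exists_extend
  cases nonempty_fintype (Omega (k + 1) (M + 1))
  obtain ⟨hle, heq⟩ := mul_finrank_inf_ker_defect_le hN ξ hξ V
  have hρ := finrank_map_add_finrank_inf_ker (extend ℂ V) (defect (M + 1) ξ)
  have hΩ : finrank ℂ (Omega (k + 1) (M + 1) → ℂ) =
      Nat.card (Theta (k + 1) (M + 1)) + Nat.card (Theta (k + 1) M) := by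
    rw [finrank_fintype_fun_eq_card, ← Nat.card_eq_fintype_card, card_Omega]
  have hF : finrank ℂ (LinearMap.ker (defect (M + 1) ξ)) = Nat.card (Theta (k + 1) (M + 1)) := by
    rw [← F_eq_ker_defect, finrank_F]
  have hcard := card_Theta_succ_mul k M
  have hbot : extend ℂ V = ⊥ ↔ finrank ℂ (extend ℂ V) = 0 := Submodule.finrank_eq_zero.symm
  have htop : finrank ℂ (extend ℂ V) = finrank ℂ (Omega (k + 1) (M + 1) → ℂ) →
      extend ℂ V = ⊤ := Submodule.eq_top_of_finrank_eq
  have htop' : extend ℂ V = ⊤ →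
      finrank ℂ (extend ℂ V) = Nat.card (Theta (k + 1) (M + 1)) + Nat.card (Theta (k + 1) M) ∧
      finrank ℂ (extend ℂ V ⊓ LinearMap.ker (defect (M + 1) ξ) : Submodule ℂ _) =
        Nat.card (Theta (k + 1) (M + 1)) := fun h => by
    rw [h, finrank_top, top_inf_eq]
    exact ⟨hΩ, hF⟩
  rw [F_eq_ker_defect, inf_comm, hbot]
  generalize finrank ℂ (extend ℂ V ⊓ LinearMap.ker (defect (M + 1) ξ) : Submodule ℂ _) = φ at *
  generalize finrank ℂ ((extend ℂ V).map (defect (M + 1) ξ)) = r at *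
  generalize finrank ℂ (extend ℂ V) = ρ at *
  generalize Nat.card (Theta (k + 1) (M + 1)) = a at *
  generalize Nat.card (Theta (k + 1) M) = b at *
  subst hρ
  have hpos : (0 : ℝ) < (M + 1 : ℝ) + k := by positivity
  -- `2 - (m - 1) / (N + m - 1) = 1 + N / (N + m - 1)`
  have hc : (2 - (((k + 1 : ℕ) : ℝ) - 1) / (((M + 1 : ℕ) : ℝ) + ((k + 1 : ℕ) : ℝ) - 1)) * (φ : ℝ) =
      φ + (M + 1) * φ / (M + 1 + k) := by
    have : ((M + 1 : ℕ) : ℝ) + ((k + 1 : ℕ) : ℝ) - 1 = M + 1 + k := by push_cast; ring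
    rw [this]
    push_cast
    field_simp
    ring
  rw [hc]
  have hleR : ((M + 1) * φ : ℝ) ≤ (M + 1 + k) * r := by exact_mod_cast hle
  constructor
  · rw [ge_iff_le, Nat.cast_add, add_comm (r : ℝ), add_le_add_iff_left, div_le_iff₀ hpos]
    linarith
  · rw [Nat.cast_add, add_comm (r : ℝ), add_right_inj, eq_div_iff hpos.ne']
    constructor
    · intro h
      have hN' : (M + 1) * φ = (M + 1 + k) * r := by
        have : ((M + 1) * φ : ℝ) = (M + 1 + k) * r := by linarith
        exact_mod_cast this
      rcases heq hN' with h0 | h0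
      · left
        subst h0
        have : r = 0 := by simpa using hN'
        omega
      · right
        refine htop ?_
        rw [hΩ]
        have : (M + 1 + k) * r = (M + 1 + k) * b := by rw [← hN', h0, ← hcard, mul_comm]
        have := Nat.eq_of_mul_eq_mul_left (by omega) this
        omega
    · rintro (h | h)
      · have h1 : r = 0 := by omega
        have h2 : φ = 0 := by omega
        simp [h1, h2]
      · obtain ⟨h1, h2⟩ := htop' h
        subst h2
        have h3 : r = b := by omega
        subst h3
        have : ((φ : ℝ) * (M + 1)) = (M + 1 + k) * r := by exact_mod_cast hcard
        linarith
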